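/- Let $G=(V,E)$ be a finite simple undirected graph whose vertices are the agents, with integer peaks $b_i\ge 1$. A b-matching is a symmetric family $f_{ij}=f_{ji}\in\mathbb Z_{\ge 0}$, with $f_{ij}=0$ unless $ij\in E$, such that $x_i(f):=\sum_j f_{ij}\le b_i$ for all $i$. Its size is $\sum_i x_i(f)$ (so each exchanged unit counts once for each of its two endpoints), and $i$ is saturated if $x_i(f)=b_i$. Let $\mu(i)=\{j: f_{ij}>0\}$. Each agent has a complete transitive single-peaked preference over quantities with peak $b_i$; a b-matching is Pareto efficient if no b-matching makes every agent weakly better off and some agent strictly better off. Let $V^U$ be the set of agents unsaturated in at least one b-matching of maximum size, $V^O$ the set of agents not in $V^U$ that have a neighbour in $V^U$, and $V^P=V\setminus(V^U\cup V^O)$. A component is a connected component $J$ of the graph induced on $V\setminus V^O$; it is odd or even according to the parity of $\sum_{j\in J}b_j$. Then: 1. In every Pareto-efficient b-matching, $\mu(i)\subseteq V^U$ for all $i\in V^O$. 2. In every Pareto-efficient b-matching, for every even component $J\subseteq V^P$, every $i\in J$ is saturated and $\mu(i)\subseteq J\setminus\{i\}$. 3. Every component $J$ with $|J|\ge 2$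 is either odd and contained in $V^U$, or even and contained in $V^P$. For every odd component $J$ with $|J|\ge2$, the maximum size of a b-matching all of whose exchanges take place inside $J$ is $\sum_{j\in J}b_j-1$. Moreover, in every Pareto-efficient b-matching, for every odd component $J$ with $|J|\ge 2$, exactly one of the following holds: (a) exactly one agent $i\in J$ is matched with an agent of $V^O$; it exchanges exactly one unit with $V^O$ and is saturated, its other partners lying in $J\setminus\{i\}$, and every $j\in J\setminus\{i\}$ is saturated with $\mu(j)\subseteq J\setminus\{j\}$; (b) exactly one agent $i\in J$ is unsaturated; it satisfies $x_i=b_i-1$ and $\mu(i)\subseteq J\setminus\{i\}$, and every $j\in J\setminus\{i\}$ is saturated with $\mu(j)\subseteq J\setminus\{j\}$. -/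

import Mathlib

/-- A binary relation `R` on quantities (`R x y`: "`x` is at least as good as `y`") is a
single-peaked preference with peak `p`: it is a complete preorder, and moving towards the peak
(from either side) is strictly better. -/
structure IsSinglePeaked (R : ℕ → ℕ → Prop) (p : ℕ) : Prop where
  total : ∀ x y, R x y ∨ R y x
  trans : ∀ x y z, R x y → R y z → R x z
  below : ∀ x y, x < y → y ≤ p → R y x ∧ ¬ R x y
  above : ∀ x y, p ≤ y → y < x → R y x ∧ ¬ R x y

/-- Total number of units that agent `i` exchanges under `f`. -/
def alloc {V : Type*} [Fintype V] (f : V → V → ℕ) (i : V) : ℕ := ∑ j, f i j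

/-- `f i j` is the (integral) number of units exchanged along the edge `ij`; edges are
uncapacitated, and agent `i` exchanges at most `b i` units. -/
structure IsBMatching {V : Type*} [Fintype V] (G : SimpleGraph V) (b : V → ℕ)
    (f : V → V → ℕ) : Prop where
  symm : ∀ i j, f i j = f j i
  eq_zero_of_not_adj : ∀ i j, ¬ G.Adj i j → f i j = 0
  alloc_le : ∀ i, alloc f i ≤ b i

/-- The size of a b-matching: the sum of all the agents' allocations. Every unit exchanged along
an edge counts once for each of its two endpoints. -/
def bSize {V : Type*} [Fintype V] (f : V → V → ℕ) : ℕ := ∑ i, alloc f i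

/-- A b-matching of the largest size. -/
def IsMaxBMatching {V : Type*} [Fintype V] (G : SimpleGraph V) (b : V → ℕ)
    (f : V → V → ℕ) : Prop :=
  IsBMatching G b f ∧ ∀ g, IsBMatching G b g → bSize g ≤ bSize f

/-- A b-matching is Pareto efficient with respect to the preference profile `R` if every
b-matching that is weakly better for all agents is indifferent to it for all agents. -/
def IsParetoEfficient {V : Type*} [Fintype V] (G : SimpleGraph V) (b : V → ℕ)
    (R : V → ℕ → ℕ → Prop) (f : V → V → ℕ) : Prop :=
  IsBMatching G b f ∧
    ∀ g, IsBMatching G b g → (∀ i, R i (alloc g i) (alloc f i)) →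
      ∀ i, R i (alloc g i) (alloc f i) ∧ R i (alloc f i) (alloc g i)

/-- `μ(i)`: the agents with whom `i` exchanges at least one unit under `f`. -/
def partners {V : Type*} (f : V → V → ℕ) (i : V) : Set V := {j | f i j ≠ 0}

/-- `V^U`: agents that are unsaturated in at least one maximum b-matching. -/
def underdemanded {V : Type*} [Fintype V] (G : SimpleGraph V) (b : V → ℕ) : Set V :=
  {i | ∃ f, IsMaxBMatching G b f ∧ alloc f i < b i}

/-- `V^O`: agents that are saturated in every maximum b-matching and have a neighbour in `V^U`. -/
def overdemanded {V : Type*} [Fintype V] (G : SimpleGraph V) (b : V → ℕ) : Set V :=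
  {i | i ∉ underdemanded G b ∧ ∃ j ∈ underdemanded G b, G.Adj i j}

/-- `V^P`: all remaining agents. -/
def perfectlyMatched {V : Type*} [Fintype V] (G : SimpleGraph V) (b : V → ℕ) : Set V :=
  (underdemanded G b ∪ overdemanded G b)ᶜ

/-- `J` is (the vertex set of) a connected component of the network obtained from `G` by deleting
the agents in `V^O`. -/
def IsComponent {V : Type*} [Fintype V] (G : SimpleGraph V) (b : V → ℕ) (J : Finset V) : Prop :=
  ∃ C : (G.induce (overdemanded G b)ᶜ).ConnectedComponent,
    (J : Set V) = (fun v : ((overdemanded G b)ᶜ : Set V) => (v : V)) '' C.supp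

/-- The sizes of the b-matchings all of whose exchanges take place inside `J`. -/
def sizesWithin {V : Type*} [Fintype V] (G : SimpleGraph V) (b : V → ℕ) (J : Finset V) : Set ℕ :=
  {s | ∃ g, IsBMatching G b g ∧ (∀ i j, g i j ≠ 0 → i ∈ J ∧ j ∈ J) ∧ bSize g = s}

/-- Agent `i` is saturated, and all its exchanges are with other agents of `J`. -/
def SaturatedWithin {V : Type*} [Fintype V] (b : V → ℕ) (f : V → V → ℕ) (J : Finset V)
    (i : V) : Prop :=
  alloc f i = b i ∧ partners f i ⊆ (J : Set V) \ {i}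

/-- Exactly one agent of `J` is matched with an agent in `V^O`. It exchanges exactly one unit with
`V^O` and is saturated, all its other partners being in `J`; all remaining agents of `J` are
saturated within `J`. -/
def OneMatchedOutside {V : Type*} [Fintype V] (G : SimpleGraph V) (b : V → ℕ)
    (f : V → V → ℕ) (J : Finset V) : Prop :=
  ∃ i ∈ J, (∃ a ∈ overdemanded G b, f i a = 1 ∧ partners f i ⊆ insert a ((J : Set V) \ {i})) ∧
    alloc f i = b i ∧ ∀ j ∈ J, j ≠ i → SaturatedWithin b f J j

/-- Exactly one agent of `J` is unsaturated. It misses exactly one unit, and all its partners are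
in `J`; all remaining agents of `J` are saturated within `J`. -/
def OneUnsaturated {V : Type*} [Fintype V] (b : V → ℕ)
    (f : V → V → ℕ) (J : Finset V) : Prop :=
  ∃ i ∈ J, alloc f i + 1 = b i ∧ partners f i ⊆ (J : Set V) \ {i} ∧
    ∀ j ∈ J, j ≠ i → SaturatedWithin b f J j

/-! Pareto efficiency enters only through maximality: a b-matching that is not maximum is dominated
agentwise by another one, and below the peaks more is strictly better. What remains is a
Gallai–Edmonds decomposition for b-matchings, and one tool drives it, `IsFlow.exchange`. Swapping
two flows along an alternating trail from `v` either moves one unit of allocation from `v` to some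
`w` in one flow and back in the other, or transfers a unit at each end from one flow to the other.

Two consequences carry the structure. Stability (`IsMaxBMatching.sub_edgeUnit`,
`underdemanded_sub_vertexUnit`): lowering a positive capacity of an overdemanded agent by one lowers
the maximum size by two and leaves `V^U` and `V^O` unchanged. Hence `V^O` trades only with `V^U`,
and by repetition `V^O` can be deleted without losing maximality. Gallai's lemma
(`NeverBothUnsaturated.trans`): never being unsaturated together is transitive through underdemanded
agents, so it spreads over a whole component.

With parity, a component of at least two underdemanded agents then misses exactly one unit
internally. That unit is either exchanged with `V^O` or not exchanged at all. -/

/-- A symmetric family of quantities supported on the edges of `G`. -/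
structure IsFlow {V : Type*} (G : SimpleGraph V) (f : V → V → ℕ) : Prop where
  symm : ∀ i j, f i j = f j i
  eq_zero_of_not_adj : ∀ i j, ¬ G.Adj i j → f i j = 0

/-! ### Unit flows and parity -/

open Classical in
/-- The indicator of the vertex `v`. -/
noncomputable def vertexUnit {V : Type*} (v i : V) : ℕ := if i = v then 1 else 0

/-- One unit exchanged along the edge `uv`. -/
noncomputable def edgeUnit {V : Type*} (u v i j : V) : ℕ :=
  vertexUnit u i * vertexUnit v j + vertexUnit v i * vertexUnit u j

section
variable {V : Type*}

@[simp] lemma vertexUnit_self (v : V) : vertexUnit v v = 1 := by simp [vertexUnit]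

lemma vertexUnit_of_ne {v i : V} (h : i ≠ v) : vertexUnit v i = 0 := by simp [vertexUnit, h]

lemma vertexUnit_le_one (v i : V) : vertexUnit v i ≤ 1 := by
  unfold vertexUnit; split <;> simp

lemma edgeUnit_symm (u v i j : V) : edgeUnit u v i j = edgeUnit u v j i := by
  unfold edgeUnit; ring

lemma edgeUnit_ne_zero {u v i j : V} (h : edgeUnit u v i j ≠ 0) :
    (i = u ∧ j = v) ∨ (i = v ∧ j = u) := by
  unfold edgeUnit vertexUnit at h
  by_contra hc
  apply h
  split_ifs <;> simp_all

lemma edgeUnit_le {G : SimpleGraph V} {f : V → V → ℕ} (hf : IsFlow G f) {u v : V}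
    (h : f u v ≠ 0) (i j : V) : edgeUnit u v i j ≤ f i j := by
  have huv : u ≠ v := by
    rintro rfl
    exact h (hf.eq_zero_of_not_adj _ _ (G.loopless.irrefl u))
  by_cases hc : (i = u ∧ j = v) ∨ (i = v ∧ j = u)
  · rcases hc with ⟨rfl, rfl⟩ | ⟨rfl, rfl⟩
    · simp [edgeUnit, vertexUnit_of_ne huv]; omega
    · rw [hf.symm i j]
      simp [edgeUnit, vertexUnit_of_ne huv]; omega
  · have : edgeUnit u v i j = 0 := by
      by_contra h0
      exact hc (edgeUnit_ne_zero h0)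
    omega

lemma isFlow_edgeUnit {G : SimpleGraph V} {u v : V} (h : G.Adj u v) : IsFlow G (edgeUnit u v) := by
  refine ⟨edgeUnit_symm u v, fun i j hij => ?_⟩
  by_contra h0
  rcases edgeUnit_ne_zero h0 with ⟨rfl, rfl⟩ | ⟨rfl, rfl⟩
  · exact hij h
  · exact hij h.symm

lemma IsFlow.add {G : SimpleGraph V} {f g : V → V → ℕ} (hf : IsFlow G f) (hg : IsFlow G g) :
    IsFlow G (f + g) :=
  ⟨fun i j => by simp [hf.symm i j, hg.symm i j],
   fun i j h => by simp [hf.eq_zero_of_not_adj i j h, hg.eq_zero_of_not_adj i j h]⟩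

lemma IsFlow.sub {G : SimpleGraph V} {f g : V → V → ℕ} (hf : IsFlow G f) (hg : IsFlow G g) :
    IsFlow G (f - g) :=
  ⟨fun i j => by simp [hf.symm i j, hg.symm i j],
   fun i j h => by simp [hf.eq_zero_of_not_adj i j h]⟩

/-- Swapping the indices pairs off the terms and the diagonal vanishes. All parity arguments rest on
this. -/
lemma sum_sum_even_of_symm {f : V → V → ℕ} (hs : ∀ i j, f i j = f j i) (hd : ∀ i, f i i = 0)
    (s : Finset V) : Even (∑ i ∈ s, ∑ j ∈ s, f i j) := by
  rw [← ZMod.natCast_eq_zero_iff_even]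
  push_cast
  rw [← Finset.sum_product']
  refine Finset.sum_involution (fun x _ => (x.2, x.1)) ?_ ?_ ?_ ?_
  · rintro ⟨i, j⟩ _
    simp only [hs j i]
    exact CharTwo.add_self_eq_zero _
  · rintro ⟨i, j⟩ _ h0 heq
    simp only [Prod.mk.injEq] at heq
    obtain ⟨rfl, -⟩ := heq
    simp [hd] at h0
  · simp +contextual
  · simp

lemma IsFlow.apply_self {G : SimpleGraph V} {f : V → V → ℕ} (hf : IsFlow G f) (i : V) :
    f i i = 0 := hf.eq_zero_of_not_adj _ _ (G.loopless.irrefl i)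

lemma sum_add_one_of_unique {J : Finset V} {b c : V → ℕ} {u : V} (hu : u ∈ J)
    (hcu : c u + 1 = b u) (hc : ∀ j ∈ J, j ≠ u → c j = b j) :
    ∑ j ∈ J, c j + 1 = ∑ j ∈ J, b j := by
  classical
  have h : ∑ j ∈ J.erase u, c j = ∑ j ∈ J.erase u, b j := Finset.sum_congr rfl fun j hj =>
    hc j (Finset.mem_of_mem_erase hj) (Finset.ne_of_mem_erase hj)
  rw [← Finset.add_sum_erase J (fun j => c j) hu, ← Finset.add_sum_erase J (fun j => b j) hu, h]
  omega

variable [Fintype V]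

lemma sum_vertexUnit (v : V) : ∑ i, vertexUnit v i = 1 := by
  classical
  simp [vertexUnit]

lemma alloc_edgeUnit (u v i : V) :
    alloc (edgeUnit u v) i = vertexUnit u i + vertexUnit v i := by
  simp [alloc, edgeUnit, Finset.sum_add_distrib, ← Finset.mul_sum, sum_vertexUnit]

lemma alloc_add (f g : V → V → ℕ) (i : V) : alloc (f + g) i = alloc f i + alloc g i := by
  simp [alloc, Finset.sum_add_distrib]

lemma alloc_sub {f g : V → V → ℕ} (h : ∀ i j, g i j ≤ f i j) (i : V) :
    alloc (f - g) i + alloc g i = alloc f i := by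
  simp only [alloc, ← Finset.sum_add_distrib]
  exact Finset.sum_congr rfl fun j _ => Nat.sub_add_cancel (h i j)

lemma IsBMatching.isFlow {G : SimpleGraph V} {b : V → ℕ} {f : V → V → ℕ}
    (hf : IsBMatching G b f) : IsFlow G f := ⟨hf.symm, hf.eq_zero_of_not_adj⟩

lemma IsFlow.isBMatching {G : SimpleGraph V} {b : V → ℕ} {f : V → V → ℕ}
    (hf : IsFlow G f) (h : ∀ i, alloc f i ≤ b i) : IsBMatching G b f :=
  ⟨hf.symm, hf.eq_zero_of_not_adj, h⟩

lemma exists_ne_zero_of_alloc_ne_zero {f : V → V → ℕ} {v : V} (h : alloc f v ≠ 0) :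
    ∃ u, f v u ≠ 0 := by
  by_contra! hc
  exact h (Finset.sum_eq_zero fun u _ => hc u)

/-! ### Alternating trails and exchange -/

/-- If `p` has larger degree than `q` at `v`, some alternating trail starts at `v` along `p` and
ends at a vertex `w` where the degrees of `p` and `q` differ in the right direction. -/
lemma exists_alternating_trail {G : SimpleGraph V} (n : ℕ) : ∀ (p q : V → V → ℕ) (v : V),
    IsFlow G p → IsFlow G q → bSize p + bSize q ≤ n → alloc q v < alloc p v →
    ∃ (p' q' : V → V → ℕ) (w : V), IsFlow G p' ∧ IsFlow G q' ∧
      (∀ i j, p' i j ≤ p i j) ∧ (∀ i j, q' i j ≤ q i j) ∧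
      (((∀ i, alloc p' i = alloc q' i + vertexUnit v i + vertexUnit w i) ∧
          alloc q w + vertexUnit v w < alloc p w) ∨
        ((∀ i, alloc p' i + vertexUnit w i = alloc q' i + vertexUnit v i) ∧
          alloc p w < alloc q w)) := by
  induction n with
  | zero =>
    intro p q v _ _ hn hv
    have : alloc p v ≤ bSize p := Finset.single_le_sum (f := alloc p) (by simp) (Finset.mem_univ v)
    omega
  | succ n ih =>
    intro p q v hp hq hn hv
    obtain ⟨u, hu⟩ := exists_ne_zero_of_alloc_ne_zero (f := p) (v := v) (by omega)
    have hadj : G.Adj v u := by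
      by_contra h
      exact hu (hp.eq_zero_of_not_adj _ _ h)
    have he := isFlow_edgeUnit hadj
    have hle := edgeUnit_le hp hu
    have huv : u ≠ v := hadj.ne'
    -- If `u` also has a surplus of `p`, the single edge `vu` is the trail. Otherwise, once that
    -- edge is removed, `q` exceeds `p` at `u`, and the trail continues from `u` with the roles
    -- swapped.
    by_cases hcase : alloc q u < alloc p u
    · refine ⟨edgeUnit v u, 0, u, he, ⟨by simp, by simp⟩, hle, by simp, Or.inl ⟨fun i => ?_, ?_⟩⟩
      · rw [alloc_edgeUnit]; simp [alloc]
      · rw [vertexUnit_of_ne huv]; omega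
    · have h1 : ∀ i, alloc (p - edgeUnit v u) i + (vertexUnit v i + vertexUnit u i) = alloc p i :=
        fun i => by rw [← alloc_edgeUnit]; exact alloc_sub hle i
      have hsize : bSize (p - edgeUnit v u) + 2 = bSize p := by
        simp only [bSize, ← h1, Finset.sum_add_distrib, sum_vertexUnit]
      have h1u := h1 u
      have h1v := h1 v
      rw [vertexUnit_self, vertexUnit_of_ne huv] at h1u
      rw [vertexUnit_self, vertexUnit_of_ne huv.symm] at h1v
      obtain ⟨q', p', w, hq', hp', hqle, hple, hw⟩ :=
        ih q (p - edgeUnit v u) u hq (hp.sub he) (by omega) (by omega)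
      have h1w := h1 w
      refine ⟨p' + edgeUnit v u, q', w, hp'.add he, hq', fun i j => ?_, hqle, ?_⟩
      · have := hple i j
        have := hle i j
        simp only [Pi.sub_apply, Pi.add_apply] at *
        omega
      · have hu1 := vertexUnit_le_one u w
        have hv1 := vertexUnit_le_one v w
        have hvw : w ≠ v → vertexUnit v w = 0 := vertexUnit_of_ne
        simp only [alloc_add, alloc_edgeUnit]
        rcases hw with ⟨h, hw⟩ | ⟨h, hw⟩
        · refine Or.inr ⟨fun i => ?_, ?_⟩
          · have := h i; omega
          · by_cases hwv : w = v
            · subst hwv; omega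
            · have := hvw hwv; omega
        · refine Or.inl ⟨fun i => ?_, ?_⟩
          · have := h i; omega
          · omega

/-- Exchange property of the allocations of two families supported on the edges of `G`. -/
lemma IsFlow.exchange {G : SimpleGraph V} {f g : V → V → ℕ} (hf : IsFlow G f) (hg : IsFlow G g)
    {v : V} (hv : alloc g v < alloc f v) :
    ∃ (f' g' : V → V → ℕ) (w : V), IsFlow G f' ∧ IsFlow G g' ∧
      (((∀ i, alloc f' i + vertexUnit v i + vertexUnit w i = alloc f i) ∧
          (∀ i, alloc g' i = alloc g i + vertexUnit v i + vertexUnit w i) ∧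
          alloc g w + vertexUnit v w < alloc f w) ∨
        ((∀ i, alloc f' i + vertexUnit v i = alloc f i + vertexUnit w i) ∧
          (∀ i, alloc g' i + vertexUnit w i = alloc g i + vertexUnit v i) ∧
          alloc f w < alloc g w)) := by
  obtain ⟨p, q, w, hp, hq, hpf, hqg, h⟩ := exists_alternating_trail _ f g v hf hg le_rfl hv
  have h1 := alloc_sub hpf
  have h2 := alloc_sub hqg
  -- Edges are uncapacitated, so swapping the two halves of the trail again gives flows on `G`.
  refine ⟨f - p + q, g - q + p, w, (hf.sub hp).add hq, (hg.sub hq).add hp, ?_⟩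
  simp only [alloc_add]
  rcases h with ⟨h, hw⟩ | ⟨h, hw⟩
  · refine Or.inl ⟨fun i => ?_, fun i => ?_, hw⟩ <;>
      (have := h i; have := h1 i; have := h2 i; omega)
  · refine Or.inr ⟨fun i => ?_, fun i => ?_, hw⟩ <;>
      (have := h i; have := h1 i; have := h2 i; omega)

/-! ### Maximum b-matchings -/

lemma IsFlow.even_bSize {G : SimpleGraph V} {f : V → V → ℕ} (hf : IsFlow G f) : Even (bSize f) :=
  sum_sum_even_of_symm hf.symm hf.apply_self Finset.univ

lemma bSize_le_sum {G : SimpleGraph V} {b : V → ℕ} {f : V → V → ℕ} (hf : IsBMatching G b f) :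
    bSize f ≤ ∑ i, b i := Finset.sum_le_sum fun i _ => hf.alloc_le i

lemma exists_isMaxBMatching (G : SimpleGraph V) (b : V → ℕ) : ∃ f, IsMaxBMatching G b f := by
  have h0 : IsBMatching G b (fun _ _ => 0) := ⟨by simp, by simp, by simp [alloc]⟩
  have hne : {n | ∃ f, IsBMatching G b f ∧ bSize f = n}.Nonempty := ⟨_, _, h0, rfl⟩
  have hbdd : BddAbove {n | ∃ f, IsBMatching G b f ∧ bSize f = n} := by
    refine ⟨∑ i, b i, ?_⟩
    rintro n ⟨f, hf, rfl⟩
    exact bSize_le_sum hf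
  obtain ⟨f, hf, hfn⟩ := Nat.sSup_mem hne hbdd
  exact ⟨f, hf, fun g hg => hfn ▸ le_csSup hbdd ⟨g, hg, rfl⟩⟩

lemma IsMaxBMatching.of_le {G : SimpleGraph V} {b : V → ℕ} {f g : V → V → ℕ}
    (hf : IsMaxBMatching G b f) (hg : IsBMatching G b g) (h : bSize f ≤ bSize g) :
    IsMaxBMatching G b g := ⟨hg, fun k hk => (hf.2 k hk).trans h⟩

lemma bSize_eq_of_alloc_add {f g : V → V → ℕ} {v w : V}
    (h : ∀ i, alloc f i + vertexUnit v i = alloc g i + vertexUnit w i) : bSize f = bSize g := by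
  have := Finset.sum_congr (rfl : (Finset.univ : Finset V) = Finset.univ) fun i _ => h i
  simp only [Finset.sum_add_distrib, sum_vertexUnit] at this
  unfold bSize
  omega

lemma bSize_eq_add_two {f g : V → V → ℕ} {v w : V}
    (h : ∀ i, alloc f i = alloc g i + vertexUnit v i + vertexUnit w i) :
    bSize f = bSize g + 2 := by
  simp only [bSize, h, Finset.sum_add_distrib, sum_vertexUnit]

lemma IsMaxBMatching.not_alloc_add_two {G : SimpleGraph V} {b : V → ℕ} {f g : V → V → ℕ}
    (hf : IsMaxBMatching G b f) (hg : IsBMatching G b g) {v w : V}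
    (h : ∀ i, alloc g i = alloc f i + vertexUnit v i + vertexUnit w i) : False := by
  have := bSize_eq_add_two h
  have := hf.2 g hg
  omega

/-- Both ends of an edge cannot be unsaturated in a maximum b-matching. -/
lemma IsMaxBMatching.not_both_of_adj {G : SimpleGraph V} {b : V → ℕ} {f : V → V → ℕ}
    (hf : IsMaxBMatching G b f) {u v : V} (h : G.Adj u v) (hu : alloc f u < b u)
    (hv : alloc f v < b v) : False := by
  have ha : ∀ i, alloc (f + edgeUnit u v) i = alloc f i + vertexUnit u i + vertexUnit v i :=
    fun i => by rw [alloc_add, alloc_edgeUnit]; ring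
  refine hf.not_alloc_add_two
    ((hf.1.isFlow.add (isFlow_edgeUnit h)).isBMatching fun i => ?_) ha
  rw [ha]
  have := hf.1.alloc_le i
  by_cases hiu : i = u
  · subst hiu; rw [vertexUnit_self, vertexUnit_of_ne h.ne]; omega
  · by_cases hiv : i = v
    · subst hiv; rw [vertexUnit_self, vertexUnit_of_ne h.ne']; omega
    · rw [vertexUnit_of_ne hiu, vertexUnit_of_ne hiv]; omega

/-- The augmenting alternative would enlarge `g` by two, so only the shift survives, as in basis
exchange for matroids. -/
lemma IsMaxBMatching.exchange {G : SimpleGraph V} {b : V → ℕ} {f g : V → V → ℕ}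
    (hf : IsMaxBMatching G b f) (hg : IsMaxBMatching G b g) {v : V}
    (hv : alloc g v < alloc f v) :
    ∃ (f' : V → V → ℕ) (w : V), IsMaxBMatching G b f' ∧
      (∀ i, alloc f' i + vertexUnit v i = alloc f i + vertexUnit w i) ∧
      alloc f w < alloc g w := by
  obtain ⟨f', g', w, hf', hg', h | h⟩ := hf.1.isFlow.exchange hg.1.isFlow hv
  · obtain ⟨-, h2, h3⟩ := h
    refine (hg.not_alloc_add_two (hg'.isBMatching fun i => ?_) h2).elim
    have := hf.1.alloc_le i
    have := hg.1.alloc_le i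
    rw [h2]
    by_cases hiw : i = w
    · subst hiw; rw [vertexUnit_self]; omega
    · rw [vertexUnit_of_ne hiw]
      by_cases hiv : i = v
      · subst hiv; rw [vertexUnit_self]; omega
      · rw [vertexUnit_of_ne hiv]; omega
  · obtain ⟨h1, -, h3⟩ := h
    refine ⟨f', w, hf.of_le (hf'.isBMatching fun i => ?_) (bSize_eq_of_alloc_add h1).ge, h1, h3⟩
    have := h1 i
    have := hf.1.alloc_le i
    by_cases hiw : i = w
    · subst hiw
      have := hg.1.alloc_le i
      rw [vertexUnit_self] at *; omega
    · rw [vertexUnit_of_ne hiw] at *; omega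

/-! ### Pareto efficiency forces maximum size -/

/-- A b-matching that is not maximum can be enlarged without decreasing any allocation. -/
lemma exists_dominating {G : SimpleGraph V} {b : V → ℕ} {f : V → V → ℕ}
    (hf : IsBMatching G b f) (n : ℕ) : ∀ g, IsBMatching G b g → bSize f < bSize g →
    ∑ i, (alloc f i - alloc g i) ≤ n →
    ∃ h, IsBMatching G b h ∧ (∀ i, alloc f i ≤ alloc h i) ∧ ∃ v, alloc f v < alloc h v := by
  induction n with
  | zero =>
    intro g hg hlt hn
    obtain ⟨v, -, hv⟩ := Finset.exists_lt_of_sum_lt hlt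
    refine ⟨g, hg, fun i => ?_, v, hv⟩
    have := Finset.single_le_sum (f := fun i => alloc f i - alloc g i) (by simp)
      (Finset.mem_univ i)
    omega
  | succ n ih =>
    intro g hg hlt hn
    obtain ⟨v, -, hv⟩ := Finset.exists_lt_of_sum_lt hlt
    -- Either the trail augments `f` itself, or it moves a unit of `g` to an agent where `g` falls
    -- short of `f`. The latter keeps the size of `g` and lowers the truncated deficit bounded by
    -- `n`.
    obtain ⟨g', f', w, hg', hf', h | h⟩ := hg.isFlow.exchange hf.isFlow hv
    · obtain ⟨-, h2, h3⟩ := h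
      refine ⟨f', hf'.isBMatching fun i => ?_, fun i => ?_, v, ?_⟩
      · have := hg.alloc_le i
        have := hf.alloc_le i
        rw [h2]
        by_cases hiw : i = w
        · subst hiw; rw [vertexUnit_self]; omega
        · rw [vertexUnit_of_ne hiw]
          by_cases hiv : i = v
          · subst hiv; rw [vertexUnit_self]; omega
          · rw [vertexUnit_of_ne hiv]; omega
      · rw [h2]; omega
      · rw [h2, vertexUnit_self]; omega
    · obtain ⟨h1, -, h3⟩ := h
      have hvw : v ≠ w := by rintro rfl; omega
      refine ih g' (hg'.isBMatching fun i => ?_) (by rw [bSize_eq_of_alloc_add h1]; exact hlt) ?_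
      · have := h1 i
        have := hg.alloc_le i
        by_cases hiw : i = w
        · subst hiw
          have := hf.alloc_le i
          rw [vertexUnit_self] at *; omega
        · rw [vertexUnit_of_ne hiw] at *; omega
      · refine Nat.le_of_lt_succ (lt_of_lt_of_le ?_ hn)
        refine Finset.sum_lt_sum (fun i _ => ?_) ⟨w, Finset.mem_univ w, ?_⟩
        · have := h1 i
          by_cases hiv : i = v
          · subst hiv
            rw [vertexUnit_self] at this; omega
          · rw [vertexUnit_of_ne hiv] at this; omega
        · have := h1 w
          rw [vertexUnit_self, vertexUnit_of_ne hvw.symm] at this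
          omega

lemma IsParetoEfficient.isMaxBMatching {G : SimpleGraph V} {b : V → ℕ}
    {R : V → ℕ → ℕ → Prop} (hR : ∀ i, IsSinglePeaked (R i) (b i)) {f : V → V → ℕ}
    (hf : IsParetoEfficient G b R f) : IsMaxBMatching G b f := by
  refine ⟨hf.1, fun g hg => ?_⟩
  by_contra! hlt
  obtain ⟨h, hh, hle, v, hv⟩ := exists_dominating hf.1 _ g hg hlt le_rfl
  have hw : ∀ i, R i (alloc h i) (alloc f i) := fun i => by
    rcases (hle i).eq_or_lt with he | hl
    · rw [he]; exact ((hR i).total _ _).elim id id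
    · exact ((hR i).below _ _ hl (hh.alloc_le i)).1
  exact ((hR v).below _ _ hv (hh.alloc_le v)).2 (hf.2 h hh hw v).2

/-! ### Stability under lowering overdemanded capacities -/

lemma IsMaxBMatching.alloc_eq_of_mem_overdemanded {G : SimpleGraph V} {b : V → ℕ}
    {f : V → V → ℕ} (hf : IsMaxBMatching G b f) {a : V} (ha : a ∉ underdemanded G b) :
    alloc f a = b a := by
  by_contra h
  exact ha ⟨f, hf, lt_of_le_of_ne (hf.1.alloc_le a) h⟩

/-- Reducing the capacity of an overdemanded agent creates no new underdemanded agents. -/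
lemma mem_underdemanded_of_sub_vertexUnit {G : SimpleGraph V} {b : V → ℕ} {a c : V}
    (ha : a ∈ overdemanded G b) (hba : b a ≠ 0) {h : V → V → ℕ}
    (hh : IsBMatching G (b - vertexUnit a) h)
    (hsize : ∀ g, IsMaxBMatching G b g → bSize g ≤ bSize h + 2)
    (hc : alloc h c < (b - vertexUnit a) c) : c ∈ underdemanded G b := by
  obtain ⟨haU, d, hd, had⟩ := ha
  by_cases hcd : c = d
  · exact hcd ▸ hd
  obtain ⟨g, hg, hgd⟩ := hd
  have hb : ∀ i, (b - vertexUnit a) i + vertexUnit a i = b i := fun i => by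
    by_cases hia : i = a
    · subst hia; simp; omega
    · simp [vertexUnit_of_ne hia]
  have hbc := hb c
  have hbd := hb d
  rw [vertexUnit_of_ne had.ne'] at hbd
  have hhle := hh.alloc_le
  -- The capacity restored at `a` is spent on the edge `ad`. If `d` is saturated in `h`, a unit is
  -- first shifted away from `d`.
  by_cases hhd : alloc h d < b d
  · have hal : ∀ i, alloc (h + edgeUnit a d) i = alloc h i + vertexUnit a i + vertexUnit d i :=
      fun i => by rw [alloc_add, alloc_edgeUnit]; ring
    refine ⟨h + edgeUnit a d, hg.of_le ((hh.isFlow.add (isFlow_edgeUnit had)).isBMatching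
      fun i => ?_) ?_, ?_⟩
    · rw [hal]
      have := hb i
      have := hhle i
      by_cases hid : i = d
      · subst hid; rw [vertexUnit_self, vertexUnit_of_ne had.ne']; omega
      · rw [vertexUnit_of_ne hid]; omega
    · rw [bSize_eq_add_two hal]; exact hsize g hg
    · rw [hal, vertexUnit_of_ne hcd]; omega
  · obtain ⟨h', g', w, hh', hg', hx | hx⟩ := hh.isFlow.exchange hg.1.isFlow (v := d) (by omega)
    · obtain ⟨-, h2, h3⟩ := hx
      refine (hg.not_alloc_add_two (hg'.isBMatching fun i => ?_) h2).elim
      have := hhle i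
      have := hb i
      have := hg.1.alloc_le i
      rw [h2]
      by_cases hiw : i = w
      · subst hiw; rw [vertexUnit_self]; omega
      · rw [vertexUnit_of_ne hiw]
        by_cases hid : i = d
        · subst hid; rw [vertexUnit_self]; omega
        · rw [vertexUnit_of_ne hid]; omega
    · obtain ⟨h1, h2, h3⟩ := hx
      have hdw : w ≠ d := by rintro rfl; omega
      -- The other half of the swap, `g'`, is maximum and takes a unit from `w`. So the shifted unit
      -- cannot land on `a`, and landing on `c` already proves the claim.
      have hwU : w ∈ underdemanded G b := by
        refine ⟨g', hg.of_le (hg'.isBMatching fun i => ?_) (bSize_eq_of_alloc_add h2).ge, ?_⟩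
        · have := h2 i
          have := hg.1.alloc_le i
          by_cases hid : i = d
          · subst hid; rw [vertexUnit_self] at *; omega
          · rw [vertexUnit_of_ne hid] at *; omega
        · have := h2 w
          have := hg.1.alloc_le w
          rw [vertexUnit_self, vertexUnit_of_ne hdw] at *; omega
      have hwa : w ≠ a := by rintro rfl; exact haU hwU
      by_cases hwc : w = c
      · exact hwc ▸ hwU
      have hal : ∀ i, alloc (h' + edgeUnit a d) i = alloc h i + vertexUnit a i + vertexUnit w i :=
        fun i => by rw [alloc_add, alloc_edgeUnit]; have := h1 i; omega
      refine ⟨h' + edgeUnit a d, hg.of_le ((hh'.add (isFlow_edgeUnit had)).isBMatching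
        fun i => ?_) ?_, ?_⟩
      · rw [hal]
        have := hb i
        have := hhle i
        by_cases hiw : i = w
        · subst hiw
          have := hg.1.alloc_le i
          rw [vertexUnit_self, vertexUnit_of_ne hwa]; omega
        · rw [vertexUnit_of_ne hiw]; omega
      · rw [bSize_eq_add_two hal]; exact hsize g hg
      · rw [hal, vertexUnit_of_ne (Ne.symm hwc)]; omega

/-- Removing one unit at an overdemanded agent from a maximum b-matching leaves a maximum
b-matching for the reduced capacities. -/
lemma IsMaxBMatching.sub_edgeUnit {G : SimpleGraph V} {b : V → ℕ} {f : V → V → ℕ}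
    (hf : IsMaxBMatching G b f) {a c : V} (ha : a ∉ underdemanded G b) (hc : f a c ≠ 0) :
    IsMaxBMatching G (b - vertexUnit a) (f - edgeUnit a c) ∧
      (∀ i, alloc f i = alloc (f - edgeUnit a c) i + vertexUnit a i + vertexUnit c i) := by
  have hadj : G.Adj a c := by
    by_contra h
    exact hc (hf.1.eq_zero_of_not_adj _ _ h)
  have hal : ∀ i, alloc f i = alloc (f - edgeUnit a c) i + vertexUnit a i + vertexUnit c i :=
    fun i => by
      have := alloc_sub (edgeUnit_le hf.1.isFlow hc) i
      rw [alloc_edgeUnit] at this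
      omega
  refine ⟨⟨(hf.1.isFlow.sub (isFlow_edgeUnit hadj)).isBMatching fun i => ?_, fun h hh => ?_⟩, hal⟩
  · have := hal i
    have := hf.1.alloc_le i
    simp only [Pi.sub_apply] at *
    omega
  · have hba : b a ≠ 0 := by
      have := hal a
      have := hf.1.alloc_le a
      rw [vertexUnit_self] at *
      omega
    have hb : IsBMatching G b h := hh.isFlow.isBMatching fun i =>
      (hh.alloc_le i).trans (Nat.sub_le _ _)
    -- Under `b`, `h` leaves `a` unsaturated, so it is not maximum. Sizes are even, so it falls
    -- short of `f` by at least two.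
    have hlt : bSize h < bSize f := by
      by_contra! hle
      refine ha ⟨h, hf.of_le hb hle, ?_⟩
      have := hh.alloc_le a
      simp only [Pi.sub_apply, vertexUnit_self] at this
      omega
    obtain ⟨k, hk⟩ := hh.isFlow.even_bSize
    obtain ⟨l, hl⟩ := hf.1.isFlow.even_bSize
    have := bSize_eq_add_two hal
    omega

/-- Overdemanded agents are matched only to underdemanded agents. -/
lemma IsMaxBMatching.partners_subset {G : SimpleGraph V} {b : V → ℕ} {f : V → V → ℕ}
    (hf : IsMaxBMatching G b f) {a : V} (ha : a ∈ overdemanded G b) :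
    partners f a ⊆ underdemanded G b := by
  intro c hc
  have hca : c ≠ a := by
    rintro rfl
    exact hc (hf.1.isFlow.apply_self c)
  obtain ⟨hmax, hal⟩ := hf.sub_edgeUnit ha.1 hc
  have hba : b a ≠ 0 := by
    have := hal a
    have := hf.1.alloc_le a
    rw [vertexUnit_self] at *
    omega
  refine mem_underdemanded_of_sub_vertexUnit ha hba hmax.1 (fun g hg => ?_) (c := c) ?_
  · rw [← bSize_eq_add_two hal]; exact hf.2 g hg.1
  · have := hal c
    have := hf.1.alloc_le c
    simp only [Pi.sub_apply, vertexUnit_self, vertexUnit_of_ne hca] at *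
    omega

/-- This invariance allows `V^O` to be deleted one unit of capacity at a time. -/
lemma underdemanded_sub_vertexUnit {G : SimpleGraph V} {b : V → ℕ} {a : V}
    (ha : a ∈ overdemanded G b) (hba : b a ≠ 0) :
    underdemanded G (b - vertexUnit a) = underdemanded G b := by
  have key : ∀ g, IsMaxBMatching G b g → ∃ c, g a c ≠ 0 := fun g hg =>
    exists_ne_zero_of_alloc_ne_zero (by rw [hg.alloc_eq_of_mem_overdemanded ha.1]; exact hba)
  ext i
  constructor
  · rintro ⟨h, hh, hi⟩
    refine mem_underdemanded_of_sub_vertexUnit ha hba hh.1 (fun g hg => ?_) hi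
    obtain ⟨c, hc⟩ := key g hg
    obtain ⟨hmax, hal⟩ := hg.sub_edgeUnit ha.1 hc
    rw [bSize_eq_add_two hal]
    exact Nat.add_le_add_right (hh.2 _ hmax.1) 2
  · rintro ⟨g, hg, hi⟩
    obtain ⟨c, hc⟩ := key g hg
    obtain ⟨hmax, hal⟩ := hg.sub_edgeUnit ha.1 hc
    refine ⟨_, hmax, ?_⟩
    have hia : i ≠ a := by
      rintro rfl
      exact ha.1 ⟨g, hg, hi⟩
    have := hal i
    simp only [Pi.sub_apply, vertexUnit_of_ne hia] at *
    omega

lemma overdemanded_sub_vertexUnit {G : SimpleGraph V} {b : V → ℕ} {a : V}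
    (ha : a ∈ overdemanded G b) (hba : b a ≠ 0) :
    overdemanded G (b - vertexUnit a) = overdemanded G b := by
  simp only [overdemanded, underdemanded_sub_vertexUnit ha hba]

/-! ### Deleting the overdemanded agents -/

open Classical in
/-- The capacities with those of the agents in `S` set to zero. -/
noncomputable def capAvoiding (S : Set V) (b : V → ℕ) (i : V) : ℕ := if i ∈ S then 0 else b i

open Classical in
/-- The exchanges in `f` that do not involve an agent of `S`. -/
noncomputable def flowAvoiding (S : Set V) (f : V → V → ℕ) (i j : V) : ℕ :=
  if i ∈ S ∨ j ∈ S then 0 else f i j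

/-- Deleting the overdemanded agents from a maximum b-matching leaves a maximum b-matching of the
remaining network. -/
lemma IsMaxBMatching.avoiding_overdemanded {G : SimpleGraph V} (n : ℕ) :
    ∀ (b : V → ℕ) (f : V → V → ℕ), ∑ i, b i ≤ n → IsMaxBMatching G b f →
      IsMaxBMatching G (capAvoiding (overdemanded G b) b)
        (flowAvoiding (overdemanded G b) f) := by
  -- Once the overdemanded capacities are exhausted, deletion changes neither the capacities nor the
  -- flow.
  have base : ∀ (b : V → ℕ) (f : V → V → ℕ), (∀ a ∈ overdemanded G b, b a = 0) →
      IsMaxBMatching G b f → IsMaxBMatching G (capAvoiding (overdemanded G b) b)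
        (flowAvoiding (overdemanded G b) f) := by
    intro b f h0 hf
    have h1 : capAvoiding (overdemanded G b) b = b := by
      ext i
      unfold capAvoiding
      split_ifs with h
      · exact (h0 i h).symm
      · rfl
    have hz : ∀ a ∈ overdemanded G b, ∀ j, f a j = 0 := fun a ha j => by
      have := hf.1.alloc_le a
      rw [h0 a ha] at this
      exact Finset.sum_eq_zero_iff.1 (Nat.le_zero.1 this) j (Finset.mem_univ j)
    have h2 : flowAvoiding (overdemanded G b) f = f := by
      ext i j
      unfold flowAvoiding
      split_ifs with h
      · rcases h with h | h
        · exact (hz i h j).symm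
        · rw [hf.1.symm]; exact (hz j h i).symm
      · rfl
    rwa [h1, h2]
  induction n with
  | zero =>
    intro b f hn
    refine base b f fun a _ => ?_
    exact Finset.sum_eq_zero_iff.1 (Nat.le_zero.1 hn) a (Finset.mem_univ a)
  | succ n ih =>
    intro b f hn hf
    by_cases h0 : ∀ a ∈ overdemanded G b, b a = 0
    · exact base b f h0 hf
    push Not at h0
    obtain ⟨a, ha, hba⟩ := h0
    obtain ⟨c, hc⟩ := exists_ne_zero_of_alloc_ne_zero (f := f) (v := a)
      (by rw [hf.alloc_eq_of_mem_overdemanded ha.1]; exact hba)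
    have hO := overdemanded_sub_vertexUnit ha hba
    have hsum : ∑ i, (b - vertexUnit a) i ≤ n := by
      refine Nat.le_of_lt_succ (lt_of_lt_of_le ?_ hn)
      refine Finset.sum_lt_sum (fun i _ => Nat.sub_le _ _) ⟨a, Finset.mem_univ a, ?_⟩
      simp only [Pi.sub_apply, vertexUnit_self]
      omega
    have := ih _ _ hsum (hf.sub_edgeUnit ha.1 hc).1
    rw [hO] at this
    have h1 : capAvoiding (overdemanded G b) (b - vertexUnit a)
        = capAvoiding (overdemanded G b) b := by
      ext i
      unfold capAvoiding
      split_ifs with h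
      · rfl
      · have hia : i ≠ a := by rintro rfl; exact h ha
        simp [vertexUnit_of_ne hia]
    have h2 : flowAvoiding (overdemanded G b) (f - edgeUnit a c)
        = flowAvoiding (overdemanded G b) f := by
      ext i j
      unfold flowAvoiding
      split_ifs with h
      · rfl
      · have hz : edgeUnit a c i j = 0 := by
          by_contra h0
          rcases edgeUnit_ne_zero h0 with ⟨rfl, -⟩ | ⟨-, rfl⟩
          · exact h (Or.inl ha)
          · exact h (Or.inr ha)
        simp [hz]
    rwa [h1, h2] at this

/-! ### Gallai's lemma -/

/-- Either `u = v`, or no maximum b-matching leaves both `u` and `v` unsaturated. -/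
def NeverBothUnsaturated (G : SimpleGraph V) (b : V → ℕ) (u v : V) : Prop :=
  u = v ∨ ∀ f, IsMaxBMatching G b f → alloc f u < b u → ¬ alloc f v < b v

/-- If `u` and `v` were both unsaturated, `t` would be saturated, and a unit could be shifted from
`t` to some `w`. As `w` is not both `u` and `v`, one of them stays unsaturated together with `t`. -/
lemma NeverBothUnsaturated.trans {G : SimpleGraph V} {b : V → ℕ} {u t v : V}
    (ht : t ∈ underdemanded G b) (hut : NeverBothUnsaturated G b u t)
    (htv : NeverBothUnsaturated G b t v) : NeverBothUnsaturated G b u v := by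
  rcases hut with rfl | hut
  · exact htv
  rcases htv with rfl | htv
  · exact Or.inr hut
  by_cases huv : u = v
  · exact Or.inl huv
  refine Or.inr fun f hf hu hv => ?_
  obtain ⟨g, hg, hgt⟩ := ht
  have hft : ¬ alloc f t < b t := hut f hf hu
  obtain ⟨f', w, hf', h, hw⟩ := hf.exchange hg (v := t) (by omega)
  have htw : t ≠ w := by
    rintro rfl
    have := hf.1.alloc_le t
    omega
  have ht' : alloc f' t < b t := by
    have := h t
    have := hf.1.alloc_le t
    rw [vertexUnit_self, vertexUnit_of_ne htw] at *
    omega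
  by_cases huw : u = w
  · have := h v
    rw [vertexUnit_of_ne (show v ≠ w from fun e => huv (huw.trans e.symm))] at this
    exact htv f' hf' ht' (by omega)
  · have := h u
    rw [vertexUnit_of_ne huw] at this
    exact hut f' hf' (by omega) ht'

/-- An agent with an underdemanded neighbour misses at most one unit in a maximum b-matching. -/
lemma IsMaxBMatching.le_alloc_add_one {G : SimpleGraph V} {b : V → ℕ} {f : V → V → ℕ}
    (hf : IsMaxBMatching G b f) {u t : V} (h : G.Adj u t) (ht : t ∈ underdemanded G b) :
    b u ≤ alloc f u + 1 := by
  by_contra! hu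
  obtain ⟨g, hg, hgt⟩ := ht
  have hft : ¬ alloc f t < b t := fun h' => hf.not_both_of_adj h (by omega) h'
  -- The unit freed at `t` may go to `u`, but `u` missed at least two, so both ends of the edge
  -- become unsaturated.
  obtain ⟨f', w, hf', hal, hw⟩ := hf.exchange hg (v := t) (by omega)
  have htw : t ≠ w := by
    rintro rfl
    have := hf.1.alloc_le t
    omega
  refine hf'.not_both_of_adj h ?_ ?_
  · have := hal u
    have := vertexUnit_le_one w u
    omega
  · have := hal t
    have := hf.1.alloc_le t
    rw [vertexUnit_self, vertexUnit_of_ne htw] at *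
    omega

/-! ### Components of the network without `V^O` -/

lemma IsComponent.notMem_overdemanded {G : SimpleGraph V} {b : V → ℕ} {J : Finset V}
    (hJ : IsComponent G b J) {i : V} (hi : i ∈ J) : i ∉ overdemanded G b := by
  obtain ⟨C, hC⟩ := hJ
  rw [← Finset.mem_coe, hC] at hi
  obtain ⟨i', -, rfl⟩ := hi
  exact i'.2

lemma IsComponent.mem_of_adj {G : SimpleGraph V} {b : V → ℕ} {J : Finset V}
    (hJ : IsComponent G b J) {i j : V} (hi : i ∈ J) (hij : G.Adj i j)
    (hj : j ∉ overdemanded G b) : j ∈ J := by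
  obtain ⟨C, hC⟩ := hJ
  rw [← Finset.mem_coe, hC] at hi ⊢
  obtain ⟨i', hi', rfl⟩ := hi
  refine ⟨⟨j, hj⟩, ?_, rfl⟩
  rw [SimpleGraph.ConnectedComponent.mem_supp_iff] at hi' ⊢
  rw [← hi', SimpleGraph.ConnectedComponent.eq]
  exact (SimpleGraph.Adj.reachable (show (G.induce (overdemanded G b)ᶜ).Adj i' ⟨j, hj⟩ from
    hij)).symm

lemma IsComponent.induction_on {G : SimpleGraph V} {b : V → ℕ} {J : Finset V}
    (hJ : IsComponent G b J) {P : V → Prop} {x : V} (hx : x ∈ J) (h0 : P x)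
    (hstep : ∀ y ∈ J, ∀ z ∈ J, G.Adj y z → P y → P z) : ∀ y ∈ J, P y := by
  have hJ' := hJ
  obtain ⟨C, hC⟩ := hJ
  intro y hy
  have hx' := hx
  rw [← Finset.mem_coe, hC] at hx' hy
  obtain ⟨x', hxC, rfl⟩ := hx'
  obtain ⟨y', hyC, rfl⟩ := hy
  rw [SimpleGraph.ConnectedComponent.mem_supp_iff] at hxC hyC
  have hr : (G.induce (overdemanded G b)ᶜ).Reachable x' y' :=
    SimpleGraph.ConnectedComponent.eq.1 (hxC.trans hyC.symm)
  rw [SimpleGraph.reachable_iff_reflTransGen] at hr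
  have : (y' : V) ∈ J ∧ P y' := by
    clear hyC
    induction hr with
    | refl => exact ⟨hx, h0⟩
    | @tail y z _ hyz ih =>
      have hadj : G.Adj y z := hyz
      have hz := hJ'.mem_of_adj ih.1 hadj z.2
      exact ⟨hz, hstep _ ih.1 _ hz hadj ih.2⟩
  exact this.2

lemma IsComponent.exists_adj {G : SimpleGraph V} {b : V → ℕ} {J : Finset V}
    (hJ : IsComponent G b J) (hcard : 2 ≤ J.card) {x : V} (hx : x ∈ J) :
    ∃ t ∈ J, G.Adj x t := by
  by_contra! hc
  have h := hJ.induction_on (P := fun y => y = x) hx rfl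
    (fun y _ z hz hyz hyx => (hc z hz (hyx ▸ hyz)).elim)
  have : J.card ≤ 1 := Finset.card_le_one.2 fun a ha c hc => (h a ha).trans (h c hc).symm
  omega

/-- A neighbour of `V^U` lies in `V^U` or `V^O`, so membership in `V^U` spreads along the component.
-/
lemma IsComponent.subset_or {G : SimpleGraph V} {b : V → ℕ} {J : Finset V}
    (hJ : IsComponent G b J) :
    (J : Set V) ⊆ underdemanded G b ∨ (J : Set V) ⊆ perfectlyMatched G b := by
  by_cases h : ∃ x ∈ J, x ∈ underdemanded G b
  · obtain ⟨x, hx, hxU⟩ := h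
    refine Or.inl (hJ.induction_on hx hxU fun y hy z hz hyz hyU => ?_)
    by_contra hzU
    exact hJ.notMem_overdemanded hz ⟨hzU, y, hyU, hyz.symm⟩
  · push Not at h
    exact Or.inr fun x hx hxU => hxU.elim (h x hx) (hJ.notMem_overdemanded hx)

/-- Edges leave a component only towards `V^O`. -/
lemma IsComponent.alloc_flowAvoiding {G : SimpleGraph V} {b : V → ℕ} {J : Finset V}
    (hJ : IsComponent G b J) {f : V → V → ℕ} (hf : IsFlow G f) {i : V} (hi : i ∈ J) :
    alloc (flowAvoiding (overdemanded G b) f) i = ∑ j ∈ J, f i j := by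
  classical
  have hiO := hJ.notMem_overdemanded hi
  symm
  rw [alloc, ← Finset.sum_subset (Finset.subset_univ J)]
  · refine Finset.sum_congr rfl fun j hj => ?_
    simp [flowAvoiding, hiO, hJ.notMem_overdemanded hj]
  · intro j _ hj
    unfold flowAvoiding
    split_ifs with h
    · rfl
    · by_contra h0
      refine hj (hJ.mem_of_adj hi ?_ fun hjO => h (Or.inr hjO))
      by_contra hadj
      exact h0 (hf.eq_zero_of_not_adj _ _ hadj)

/-! ### Odd and even components -/

/-- A component of at least two underdemanded agents misses exactly one unit internally in every
maximum b-matching. -/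
lemma IsComponent.exists_unique_deficient {G : SimpleGraph V} {b : V → ℕ} {J : Finset V}
    (hJ : IsComponent G b J) (hcard : 2 ≤ J.card) (hU : (J : Set V) ⊆ underdemanded G b)
    {f : V → V → ℕ} (hf : IsMaxBMatching G b f) :
    ∃ u ∈ J, (∑ j ∈ J, f u j) + 1 = b u ∧ ∀ i ∈ J, i ≠ u → ∑ j ∈ J, f i j = b i := by
  set O := overdemanded G b with hO
  have hcap : ∀ i ∈ J, capAvoiding O b i = b i := fun i hi => by
    simp [capAvoiding, hO, hJ.notMem_overdemanded hi]
  have hmax : ∀ g, IsMaxBMatching G b g → IsMaxBMatching G (capAvoiding O b) (flowAvoiding O g) :=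
    fun g hg => hg.avoiding_overdemanded _ b g le_rfl
  have hle : ∀ g, IsMaxBMatching G b g → ∀ i ∈ J, ∑ j ∈ J, g i j ≤ alloc g i :=
    fun g _ i _ => Finset.sum_le_sum_of_subset (Finset.subset_univ J)
  have hU' : ∀ i ∈ J, i ∈ underdemanded G (capAvoiding O b) := fun i hi => by
    obtain ⟨g, hg, hgi⟩ := hU hi
    refine ⟨_, hmax g hg, ?_⟩
    rw [hcap i hi, hJ.alloc_flowAvoiding hg.1.isFlow hi]
    exact (hle g hg i hi).trans_lt hgi
  have hnever : ∀ u ∈ J, ∀ v ∈ J, NeverBothUnsaturated G (capAvoiding O b) u v :=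
    fun u hu => hJ.induction_on hu (Or.inl rfl) fun y hy z hz hyz h =>
      h.trans (hU' y hy) (Or.inr fun k hk h1 h2 => hk.not_both_of_adj hyz h1 h2)
  have halt : ∀ g, IsMaxBMatching G b g → ∀ u ∈ J, ∑ j ∈ J, g u j < b u →
      (∑ j ∈ J, g u j) + 1 = b u ∧ ∀ i ∈ J, i ≠ u → ∑ j ∈ J, g i j = b i := by
    intro g hg u hu hlt
    have hm := hmax g hg
    have hal := fun i hi => hJ.alloc_flowAvoiding (i := i) hg.1.isFlow hi
    obtain ⟨t, htJ, hadj⟩ := hJ.exists_adj hcard hu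
    have h1 := hm.le_alloc_add_one hadj (hU' t htJ)
    rw [hal u hu, hcap u hu] at h1
    refine ⟨by omega, fun i hi hiu => ?_⟩
    have h2 := (hnever u hu i hi).resolve_left (Ne.symm hiu) _ hm
    rw [hal u hu, hcap u hu, hal i hi, hcap i hi] at h2
    have := h2 hlt
    have := hle g hg i hi
    have := hg.1.alloc_le i
    omega
  by_cases hex : ∃ u ∈ J, ∑ j ∈ J, f u j < b u
  · obtain ⟨u, hu, hlt⟩ := hex
    exact ⟨u, hu, halt f hf u hu hlt⟩
  · exfalso
    push Not at hex
    obtain ⟨u, hu⟩ : J.Nonempty := Finset.card_pos.1 (by omega)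
    obtain ⟨g, hg, hgu⟩ := hU hu
    obtain ⟨h1, h2⟩ := halt g hg u hu ((hle g hg u hu).trans_lt hgu)
    have h3 := sum_add_one_of_unique (c := fun i => ∑ j ∈ J, g i j) hu h1 h2
    have h4 : ∑ i ∈ J, ∑ j ∈ J, f i j = ∑ i ∈ J, b i := Finset.sum_congr rfl fun i hi =>
      le_antisymm ((hle f hf i hi).trans (hf.1.alloc_le i)) (hex i hi)
    obtain ⟨k, hk⟩ := sum_sum_even_of_symm hg.1.symm hg.1.isFlow.apply_self J
    obtain ⟨l, hl⟩ := sum_sum_even_of_symm hf.1.symm hf.1.isFlow.apply_self J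
    omega

lemma IsComponent.odd_sum {G : SimpleGraph V} {b : V → ℕ} {J : Finset V}
    (hJ : IsComponent G b J) (hcard : 2 ≤ J.card) (hU : (J : Set V) ⊆ underdemanded G b) :
    Odd (∑ i ∈ J, b i) := by
  obtain ⟨f, hf⟩ := exists_isMaxBMatching G b
  obtain ⟨u, hu, h1, h2⟩ := hJ.exists_unique_deficient hcard hU hf
  rw [← sum_add_one_of_unique (c := fun i => ∑ j ∈ J, f i j) hu h1 h2]
  exact (sum_sum_even_of_symm hf.1.symm hf.1.isFlow.apply_self J).add_one

lemma saturatedWithin_of_partners_subset {G : SimpleGraph V} {b : V → ℕ} {J : Finset V}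
    {f : V → V → ℕ} (hf : IsFlow G f) {i : V} (h : alloc f i = b i)
    (hp : ∀ j, f i j ≠ 0 → j ∈ J) : SaturatedWithin b f J i := by
  refine ⟨h, fun j hj => ⟨hp j hj, ?_⟩⟩
  rintro rfl
  exact hj (hf.apply_self j)

/-- A partner in `V^O` would put `i` into `V^U`. -/
lemma IsComponent.saturatedWithin {G : SimpleGraph V} {b : V → ℕ} {J : Finset V}
    (hJ : IsComponent G b J) (hP : (J : Set V) ⊆ perfectlyMatched G b)
    {f : V → V → ℕ} (hf : IsMaxBMatching G b f) {i : V} (hi : i ∈ J) :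
    SaturatedWithin b f J i := by
  have hiU : i ∉ underdemanded G b := fun h => hP hi (Or.inl h)
  refine saturatedWithin_of_partners_subset hf.1.isFlow (hf.alloc_eq_of_mem_overdemanded hiU)
    fun j hj => hJ.mem_of_adj hi ?_ fun hjO => ?_
  · by_contra hadj
    exact hj (hf.1.eq_zero_of_not_adj _ _ hadj)
  · refine hiU (hf.partners_subset hjO ?_)
    rw [hf.1.symm] at hj
    exact hj

lemma IsComponent.even_sum {G : SimpleGraph V} {b : V → ℕ} {J : Finset V}
    (hJ : IsComponent G b J) (hP : (J : Set V) ⊆ perfectlyMatched G b) :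
    Even (∑ i ∈ J, b i) := by
  obtain ⟨f, hf⟩ := exists_isMaxBMatching G b
  have : ∑ i ∈ J, b i = ∑ i ∈ J, ∑ j ∈ J, f i j := by
    refine Finset.sum_congr rfl fun i hi => ?_
    obtain ⟨h1, h2⟩ := hJ.saturatedWithin hP hf hi
    rw [← h1, alloc]
    symm
    refine Finset.sum_subset (Finset.subset_univ J) fun j _ hj => ?_
    by_contra h0
    exact hj (h2 h0).1
  rw [this]
  exact sum_sum_even_of_symm hf.1.symm hf.1.isFlow.apply_self J

lemma alloc_eq_sum_add_sum_compl [DecidableEq V] (f : V → V → ℕ) (J : Finset V) (i : V) :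
    alloc f i = ∑ j ∈ J, f i j + ∑ j ∈ Jᶜ, f i j := (Finset.sum_add_sum_compl J (f i)).symm

lemma IsComponent.oneMatchedOutside_or_oneUnsaturated {G : SimpleGraph V} {b : V → ℕ}
    {J : Finset V} (hJ : IsComponent G b J) (hcard : 2 ≤ J.card)
    (hU : (J : Set V) ⊆ underdemanded G b) {f : V → V → ℕ} (hf : IsMaxBMatching G b f) :
    OneMatchedOutside G b f J ∨ OneUnsaturated b f J := by
  classical
  obtain ⟨u, hu, h1, h2⟩ := hJ.exists_unique_deficient hcard hU hf
  have hsplit := alloc_eq_sum_add_sum_compl f J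
  have hrest : ∀ j ∈ J, j ≠ u → SaturatedWithin b f J j := fun j hj hju => by
    have := h2 j hj hju
    have := hsplit j
    have := hf.1.alloc_le j
    have hz : ∑ k ∈ Jᶜ, f j k = 0 := by omega
    refine saturatedWithin_of_partners_subset hf.1.isFlow (by omega) fun k hk => ?_
    by_contra hkJ
    exact hk (Finset.sum_eq_zero_iff.1 hz k (Finset.mem_compl.2 hkJ))
  have hsu := hsplit u
  have hfu := hf.1.alloc_le u
  have hself : f u u = 0 := hf.1.isFlow.apply_self u
  -- At most one unit of `u` is left for the outside, and an outside partner must lie in `V^O`.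
  by_cases hz : ∑ k ∈ Jᶜ, f u k = 0
  · refine Or.inr ⟨u, hu, by omega, fun k hk => ⟨?_, ?_⟩, hrest⟩
    · by_contra hkJ
      exact hk (Finset.sum_eq_zero_iff.1 hz k (Finset.mem_compl.2 hkJ))
    · rintro rfl
      exact hk hself
  · obtain ⟨a, haJ, ha⟩ := Finset.exists_ne_zero_of_sum_ne_zero hz
    have hadd := Finset.add_sum_erase Jᶜ (f u) haJ
    have haO : a ∈ overdemanded G b := by
      by_contra haO
      refine Finset.mem_compl.1 haJ (hJ.mem_of_adj hu ?_ haO)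
      by_contra hadj
      exact ha (hf.1.eq_zero_of_not_adj _ _ hadj)
    refine Or.inl ⟨u, hu, ⟨a, haO, by omega, fun k hk => ?_⟩, by omega, hrest⟩
    by_cases hka : k = a
    · exact Or.inl hka
    refine Or.inr ⟨?_, ?_⟩
    · by_contra hkJ
      exact hk (Finset.sum_eq_zero_iff.1 (show ∑ x ∈ Jᶜ.erase a, f u x = 0 by omega) k
        (Finset.mem_erase.2 ⟨hka, Finset.mem_compl.2 hkJ⟩))
    · rintro rfl
      exact hk hself

lemma not_oneMatchedOutside_and_oneUnsaturated {G : SimpleGraph V} {b : V → ℕ}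
    {J : Finset V} {f : V → V → ℕ} (h1 : OneMatchedOutside G b f J)
    (h2 : OneUnsaturated b f J) : False := by
  obtain ⟨i, -, -, hi, hrest⟩ := h1
  obtain ⟨k, hk, hkb, -⟩ := h2
  by_cases hki : k = i
  · subst hki; omega
  · have := (hrest k hk hki).1
    omega

/-- Restricting any maximum b-matching to `J` attains the value; the next larger one is odd, hence
not a size. -/
lemma IsComponent.isGreatest_sizesWithin {G : SimpleGraph V} {b : V → ℕ}
    {J : Finset V} (hJ : IsComponent G b J) (hcard : 2 ≤ J.card)
    (hU : (J : Set V) ⊆ underdemanded G b) :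
    IsGreatest (sizesWithin G b J) ((∑ i ∈ J, b i) - 1) := by
  classical
  constructor
  · obtain ⟨f, hf⟩ := exists_isMaxBMatching G b
    obtain ⟨u, hu, h1, h2⟩ := hJ.exists_unique_deficient hcard hU hf
    have hsum := sum_add_one_of_unique (c := fun i => ∑ j ∈ J, f i j) hu h1 h2
    have hal : ∀ i, alloc (fun i j => if i ∈ J ∧ j ∈ J then f i j else 0) i =
        if i ∈ J then ∑ j ∈ J, f i j else 0 := fun i => by
      by_cases hi : i ∈ J <;> simp [alloc, hi, Finset.sum_ite_mem]
    refine ⟨fun i j => if i ∈ J ∧ j ∈ J then f i j else 0, ⟨fun i j => ?_, fun i j h => ?_,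
      fun i => ?_⟩, fun i j h => ?_, ?_⟩
    · simp only [and_comm, hf.1.symm i j]
    · simp [hf.1.eq_zero_of_not_adj i j h]
    · rw [hal]
      split_ifs
      · exact (Finset.sum_le_sum_of_subset (Finset.subset_univ J)).trans (hf.1.alloc_le i)
      · exact Nat.zero_le _
    · by_contra hc
      simp [hc] at h
    · simp only [bSize, hal, Finset.sum_ite_mem, Finset.univ_inter]
      omega
  · rintro s ⟨g, hg, hgJ, rfl⟩
    have hle : bSize g ≤ ∑ i ∈ J, b i := by
      rw [bSize, ← Finset.sum_subset (Finset.subset_univ J)]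
      · exact Finset.sum_le_sum fun i _ => hg.alloc_le i
      · intro i _ hi
        refine Finset.sum_eq_zero fun j _ => ?_
        by_contra h0
        exact hi (hgJ i j h0).1
    obtain ⟨k, hk⟩ := hg.isFlow.even_bSize
    obtain ⟨l, hl⟩ := hJ.odd_sum hcard hU
    omega

lemma IsComponent.odd_or_even {G : SimpleGraph V} {b : V → ℕ} {J : Finset V}
    (hJ : IsComponent G b J) (hcard : 2 ≤ J.card) :
    (Odd (∑ i ∈ J, b i) ∧ (J : Set V) ⊆ underdemanded G b) ∨
      (Even (∑ i ∈ J, b i) ∧ (J : Set V) ⊆ perfectlyMatched G b) :=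
  hJ.subset_or.imp (fun h => ⟨hJ.odd_sum hcard h, h⟩) fun h => ⟨hJ.even_sum h, h⟩

lemma IsComponent.subset_underdemanded_of_odd {G : SimpleGraph V} {b : V → ℕ} {J : Finset V}
    (hJ : IsComponent G b J) (hodd : Odd (∑ i ∈ J, b i)) :
    (J : Set V) ⊆ underdemanded G b :=
  hJ.subset_or.resolve_right fun h => Nat.not_even_iff_odd.2 hodd (hJ.even_sum h)

end

theorem mainTheorem4 {V : Type*} [Fintype V] (G : SimpleGraph V) (b : V → ℕ)
    (hb : ∀ i, 0 < b i) (R : V → ℕ → ℕ → Prop) (hR : ∀ i, IsSinglePeaked (R i) (b i)) :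
    -- agents in `V^O` are matched only to `V^U`
    (∀ f, IsParetoEfficient G b R f →
      ∀ i ∈ overdemanded G b, partners f i ⊆ underdemanded G b) ∧
    -- even components contained in `V^P`
    (∀ f, IsParetoEfficient G b R f →
      ∀ J, IsComponent G b J → Even (∑ i ∈ J, b i) → (J : Set V) ⊆ perfectlyMatched G b →
        ∀ i ∈ J, SaturatedWithin b f J i) ∧
    -- the odd components with at least two agents are those in `V^U`; the even ones are in `V^P`
    (∀ J, IsComponent G b J → 2 ≤ J.card →
      (Odd (∑ i ∈ J, b i) ∧ (J : Set V) ⊆ underdemanded G b) ∨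
        (Even (∑ i ∈ J, b i) ∧ (J : Set V) ⊆ perfectlyMatched G b)) ∧
    -- internal maximum size of an odd component
    (∀ J, IsComponent G b J → Odd (∑ i ∈ J, b i) → 2 ≤ J.card →
      IsGreatest (sizesWithin G b J) ((∑ i ∈ J, b i) - 1)) ∧
    -- odd components under a Pareto-efficient b-matching
    (∀ f, IsParetoEfficient G b R f →
      ∀ J, IsComponent G b J → Odd (∑ i ∈ J, b i) → 2 ≤ J.card →
        Xor (OneMatchedOutside G b f J) (OneUnsaturated b f J)) := by
  have hmax := fun f (hf : IsParetoEfficient G b R f) => hf.isMaxBMatching hR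
  refine ⟨fun f hf i hi => (hmax f hf).partners_subset hi,
    fun f hf J hJ _ hP i hi => hJ.saturatedWithin hP (hmax f hf) hi,
    fun J hJ hcard => hJ.odd_or_even hcard,
    fun J hJ hodd hcard =>
      hJ.isGreatest_sizesWithin hcard (hJ.subset_underdemanded_of_odd hodd),
    fun f hf J hJ hodd hcard => ?_⟩
  rcases hJ.oneMatchedOutside_or_oneUnsaturated hcard (hJ.subset_underdemanded_of_odd hodd)
    (hmax f hf) with h | h
  · exact Or.inl ⟨h, fun h' => not_oneMatchedOutside_and_oneUnsaturated h h'⟩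
  · exact Or.inr ⟨h, fun h' => not_oneMatchedOutside_and_oneUnsaturated h' h⟩
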